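/- Let $(M,d)$ be a Hadamard space (a complete geodesic metric space satisfying the CAT(0) triangle comparison), and let $G:M\to(-\infty,\infty]$ be lower semicontinuous and convex along geodesics, with $\operatorname{Dom}(G)=G^{-1}(\mathbb R)$. The slope of $G$ is $$|\partial G|(y)=\limsup_{z\to y,\ z\ne y}\frac{\max\{G(y)-G(z),0\}}{d(y,z)}\in[0,\infty]\quad (y\in\operatorname{Dom}(G)),\qquad |\partial G|(y)=\infty\quad (G(y)=\infty),$$ where the upper limit is read as $0$ if $y$ is an isolated point (this happens only if $M=\{y\}$). For $c_0\in\operatorname{Dom}(G)$, the weak gradient flow of $G$ starting from $c_0$ is the curve $(c_t)_{t\ge 0}$ in $M$ given by $c_t=\lim_{m\to\infty}c_t^{m,m}$, where, for $m\ge 1$, $c_t^{m,0}=c_0$ and $c_t^{m,j+1}$ is the minimizer over $v\in M$ of $\tfrac12 d(v,c_t^{m,j})^2+\tfrac{t}{m}G(v)$ (with $0\cdot\infty=0$). Let $\phi_0,\psi_0\in\operatorname{Dom}(G)$, and let $\phi_t$ and $\psi_t$ be the weak gradient flows of $G$ starting from $\phi_0$ and $\psi_0$. Then the limits of $|\partial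 G|(\phi_t)$ and $|\partial G|(\psi_t)$ as $t\to\infty$ exist, are finite, and coincide: $$\lim_{t\to\infty}|\partial G|(\phi_t)=\lim_{t\to\infty}|\partial G|(\psi_t)\in[0,\infty).$$ -/

import Mathlib

open Filter Topology
open scoped ENNReal NNReal

/-- A (constant speed, parametrized on `[0,1]`) geodesic in a metric space. Only the values of `γ`
on `[0,1]` matter; continuity there is automatic. -/
def IsGeodesic {M : Type*} [MetricSpace M] (γ : ℝ → M) : Prop :=
  ∀ s ∈ Set.Icc (0 : ℝ) 1, ∀ t ∈ Set.Icc (0 : ℝ) 1,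
    dist (γ s) (γ t) = dist (γ 0) (γ 1) * |s - t|

/-- A Hadamard space: a complete geodesic metric space satisfying the CAT(0) comparison inequality
for geodesic triangles. In a geodesic triangle with vertices `x, y, z` only the two sides `γ` (from
`x` to `y`) and `η` (from `x` to `z`) enter the inequality; the third side exists because the space
is geodesic. The points `x' y' z'` are the vertices of a companion triangle in the Euclidean plane,
and `a'`, `b'` are the companion points of `a = γ s` and `b = η t`. -/
class HadamardSpace (M : Type*) [MetricSpace M] : Prop extends CompleteSpace M where
  exists_geodesic : ∀ x y : M, ∃ γ : ℝ → M, IsGeodesic γ ∧ γ 0 = x ∧ γ 1 = y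
  cat_zero : ∀ (x y z : M) (γ η : ℝ → M),
    IsGeodesic γ → γ 0 = x → γ 1 = y →
    IsGeodesic η → η 0 = x → η 1 = z →
    ∀ x' y' z' : EuclideanSpace ℝ (Fin 2),
      dist x' y' = dist x y → dist y' z' = dist y z → dist z' x' = dist z x →
      ∀ s ∈ Set.Icc (0 : ℝ) 1, ∀ t ∈ Set.Icc (0 : ℝ) 1,
      ∀ a' ∈ segment ℝ x' y', dist (γ s) y = dist a' y' →
      ∀ b' ∈ segment ℝ x' z', dist (η t) z = dist b' z' →
        dist (γ s) (η t) ≤ dist a' b'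

/-- Convexity of an extended-real function along all geodesics (to be used for functions that do
not take the value `-∞`; note `0 * ⊤ = 0` in `EReal`, so the endpoints impose nothing). -/
def GeodesicallyConvex {M : Type*} [MetricSpace M] (G : M → EReal) : Prop :=
  ∀ γ : ℝ → M, IsGeodesic γ → ∀ t ∈ Set.Icc (0 : ℝ) 1,
    G (γ t) ≤ ((1 - t : ℝ) : EReal) * G (γ 0) + ((t : ℝ) : EReal) * G (γ 1)

/-- The domain `G⁻¹(ℝ)` of an extended-real function. -/
def effDom {M : Type*} (G : M → EReal) : Set M :=
  {x | ∃ r : ℝ, G x = (r : EReal)}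

open Classical in
/-- The slope `|∂G| : M → [0,∞]`: `limsup_{z → y} max (G y - G z) 0 / d(y,z)` at points of the
domain and `∞` elsewhere. `EReal.toENNReal` takes the maximum with `0`. -/
noncomputable def slopeAt {M : Type*} [MetricSpace M] (G : M → EReal) (y : M) : ℝ≥0∞ :=
  if y ∈ effDom G then limsup (fun z => (G y - G z).toENNReal / edist y z) (𝓝[≠] y) else ⊤

/-- `v` is a minimizer of `w ↦ d(w,x)² / 2 + τ G(w)` over `M`. -/
def IsProximalPoint {M : Type*} [MetricSpace M] (G : M → EReal) (τ : ℝ) (x v : M) : Prop :=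
  ∀ w : M, ((dist v x ^ 2 / 2 : ℝ) : EReal) + (τ : EReal) * G v ≤
    ((dist w x ^ 2 / 2 : ℝ) : EReal) + (τ : EReal) * G w

/-- `c : [0,∞) → M` is the weak gradient flow of `G` starting from `c₀`: for each `t ≥ 0`, `c t` is
the limit as `m → ∞` of the `m`-th iterate, from `c₀`, of the proximal step of size `t / m`. -/
def IsWeakGradientFlow {M : Type*} [MetricSpace M] (G : M → EReal) (c₀ : M) (c : ℝ → M) : Prop :=
  ∃ p : ℕ → ℕ → ℝ → M, ∀ t : ℝ, 0 ≤ t →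
    (∀ m : ℕ, 0 < m → p m 0 t = c₀ ∧
      ∀ j : ℕ, IsProximalPoint G (t / m) (p m j t) (p m (j + 1) t)) ∧
    Tendsto (fun m : ℕ => p m m t) atTop (𝓝 (c t))

/-! Both limits equal `⨅ z, slopeAt G z`. Since the slope is never below this infimum, it suffices
that for each `z` of finite slope, `|∂G|(c_t) ≤ |∂G|(z) + d(z, c₀) / t`
(`IsWeakGradientFlow.slopeAt_le`). The bound is proved for proximal iterates and passed to the
limit. CAT(0) convexity of the squared distance gives a discrete evolution variational inequality
(`IsProximalPoint.evi`), so a step of length `δ` and size `τ` ends at a point of slope at most `δ /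
τ`. A weighted energy sum bounds the last `δ` (`proximal_last_step_le`). By convexity, slope bounds
are global lower bounds on `G`, which survive limits by lower semicontinuity. -/

/-- Every triple of side lengths satisfying the triangle inequalities is realized in the plane. -/
theorem exists_planar_triangle {a b c : ℝ} (ha : 0 ≤ a) (hc : 0 ≤ c)
    (h₁ : a ≤ b + c) (h₂ : b ≤ a + c) (h₃ : c ≤ a + b) :
    ∃ x y z : EuclideanSpace ℝ (Fin 2), dist x y = a ∧ dist y z = b ∧ dist z x = c := by
  have hb : 0 ≤ b := by linarith
  rcases ha.eq_or_lt with rfl | ha'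
  · obtain rfl : b = c := by linarith
    refine ⟨!₂[0, 0], !₂[0, 0], !₂[b, 0], ?_, ?_, ?_⟩ <;>
      simp [EuclideanSpace.dist_eq, Real.dist_eq, Fin.sum_univ_two, Real.sqrt_sq hb]
  -- Law of cosines: `u` is the first coordinate of `z` when `x` is the origin and `y = (a, 0)`.
  · set u := (a ^ 2 + c ^ 2 - b ^ 2) / (2 * a) with hu
    have hua : 2 * a * u = a ^ 2 + c ^ 2 - b ^ 2 := by rw [hu]; field_simp
    have hle : u ≤ c := by
      have : 2 * a * u ≤ 2 * a * c := by rw [hua]; nlinarith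
      exact le_of_mul_le_mul_left this (by positivity)
    have hge : -c ≤ u := by
      have : 2 * a * (-c) ≤ 2 * a * u := by rw [hua]; nlinarith
      exact le_of_mul_le_mul_left this (by positivity)
    have hv : 0 ≤ c ^ 2 - u ^ 2 := by nlinarith
    refine ⟨!₂[0, 0], !₂[a, 0], !₂[u, √(c ^ 2 - u ^ 2)], ?_, ?_, ?_⟩
    · simp [EuclideanSpace.dist_eq, Real.dist_eq, Fin.sum_univ_two, Real.sqrt_sq ha]
    · simp only [EuclideanSpace.dist_eq, Real.dist_eq, Fin.sum_univ_two, sq_abs]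
      simp only [Matrix.cons_val_zero, Matrix.cons_val_one, zero_sub, neg_sq,
        Real.sq_sqrt hv]
      rw [show (a - u) ^ 2 + (c ^ 2 - u ^ 2) = b ^ 2 by linarith, Real.sqrt_sq hb]
    · simp only [EuclideanSpace.dist_eq, Real.dist_eq, Fin.sum_univ_two, sq_abs]
      simp only [Matrix.cons_val_zero, Matrix.cons_val_one, sub_zero,
        Real.sq_sqrt hv]
      rw [show u ^ 2 + (c ^ 2 - u ^ 2) = c ^ 2 by ring, Real.sqrt_sq hc]

/-- Stewart's identity along a segment in an inner product space. -/
theorem dist_lineMap_sq {E : Type*} [NormedAddCommGroup E] [InnerProductSpace ℝ E] (x y z : E)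
    (s : ℝ) : dist (AffineMap.lineMap x y s) z ^ 2 =
      (1 - s) * dist x z ^ 2 + s * dist y z ^ 2 - s * (1 - s) * dist x y ^ 2 := by
  have e₁ : AffineMap.lineMap x y s - z = (1 - s) • (x - z) + s • (y - z) := by
    rw [AffineMap.lineMap_apply_module]; module
  have e₂ : x - y = (x - z) - (y - z) := by abel
  rw [dist_eq_norm, dist_eq_norm, dist_eq_norm, dist_eq_norm, e₁, e₂, norm_add_sq_real,
    norm_sub_sq_real (x - z) (y - z), norm_smul, norm_smul, mul_pow, mul_pow, real_inner_smul_left,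
    real_inner_smul_right, Real.norm_eq_abs, Real.norm_eq_abs, sq_abs, sq_abs]
  ring

theorem effDom_of_le_coe {M : Type*} {G : M → EReal} (hbot : ∀ x, G x ≠ ⊥) {x : M}
    {r : ℝ} (h : G x ≤ r) : x ∈ effDom G :=
  ⟨(G x).toReal, (EReal.coe_toReal (h.trans_lt (EReal.coe_lt_top r)).ne (hbot x)).symm⟩

section Hadamard

variable {M : Type*} [MetricSpace M]

theorem IsGeodesic.dist_zero_left {γ : ℝ → M} (hγ : IsGeodesic γ) {s : ℝ}
    (hs : s ∈ Set.Icc (0 : ℝ) 1) : dist (γ 0) (γ s) = s * dist (γ 0) (γ 1) := by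
  rw [hγ 0 (by simp) s hs, zero_sub, abs_neg, abs_of_nonneg hs.1, mul_comm]

/-- Uniform convexity of the squared distance in a Hadamard space. -/
theorem IsGeodesic.dist_sq_le [HadamardSpace M] {γ : ℝ → M} (hγ : IsGeodesic γ) (p : M) {s : ℝ}
    (hs : s ∈ Set.Icc (0 : ℝ) 1) :
    dist (γ s) p ^ 2 ≤ (1 - s) * dist (γ 0) p ^ 2 + s * dist (γ 1) p ^ 2
      - s * (1 - s) * dist (γ 0) (γ 1) ^ 2 := by
  obtain ⟨η, hη, hη₀, hη₁⟩ := HadamardSpace.exists_geodesic (γ 0) p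
  obtain ⟨x, y, z, hxy, hyz, hzx⟩ := exists_planar_triangle
    (a := dist (γ 0) (γ 1)) (b := dist (γ 1) p) (c := dist p (γ 0)) dist_nonneg dist_nonneg
    (by linarith [dist_triangle_right (γ 0) (γ 1) p, dist_comm p (γ 0)])
    (by linarith [dist_triangle_left (γ 1) p (γ 0), dist_comm p (γ 0)])
    (by linarith [dist_triangle_right p (γ 0) (γ 1), dist_comm p (γ 1)])
  have key : dist (γ s) (η 1) ≤ dist (AffineMap.lineMap x y s) z := by
    -- With parameter `1` on the side `η`, the comparison is between `γ s` and the vertex `p`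
    -- itself.
    refine HadamardSpace.cat_zero (γ 0) (γ 1) p γ η hγ rfl rfl hη hη₀ hη₁ x y z hxy hyz hzx
      s hs 1 (by simp) _ ?_ ?_ z (right_mem_segment ℝ x z) (by simp [hη₁])
    · rw [segment_eq_image_lineMap]
      exact ⟨s, hs, rfl⟩
    · rw [hγ s hs 1 (by simp), dist_lineMap_right, hxy, Real.norm_eq_abs, abs_sub_comm, mul_comm]
  rw [hη₁] at key
  calc dist (γ s) p ^ 2 ≤ dist (AffineMap.lineMap x y s) z ^ 2 := by gcongr
    _ = _ := by rw [dist_lineMap_sq, hxy, hyz, dist_comm x z, hzx, dist_comm p (γ 0)]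

variable {G : M → EReal}

theorem GeodesicallyConvex.le_coe (hconv : GeodesicallyConvex G) {γ : ℝ → M} (hγ : IsGeodesic γ)
    {a b : ℝ} (ha : G (γ 0) = a) (hb : G (γ 1) = b) {s : ℝ} (hs : s ∈ Set.Icc (0 : ℝ) 1) :
    G (γ s) ≤ (((1 - s) * a + s * b : ℝ) : EReal) := by
  have := hconv γ hγ s hs
  rw [ha, hb] at this
  exact_mod_cast this

/-! ### Estimates for one proximal step -/

theorem IsProximalPoint.mem_effDom (hbot : ∀ x, G x ≠ ⊥) {τ : ℝ} (hτ : 0 < τ) {x v w : M}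
    (hv : IsProximalPoint G τ x v) (hw : w ∈ effDom G) : v ∈ effDom G := by
  obtain ⟨r, hr⟩ := hw
  have h := hv w
  by_contra hcon
  have htop : G v = ⊤ := by
    by_contra hne
    exact hcon ⟨(G v).toReal, (EReal.coe_toReal hne (hbot v)).symm⟩
  rw [htop, hr, EReal.coe_mul_top_of_pos hτ, EReal.coe_add_top, top_le_iff] at h
  exact EReal.coe_ne_top (dist w x ^ 2 / 2 + τ * r) (by exact_mod_cast h)

/-- The discrete evolution variational inequality for a proximal step. -/
theorem IsProximalPoint.evi [HadamardSpace M] (hbot : ∀ x, G x ≠ ⊥) (hconv : GeodesicallyConvex G)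
    {τ : ℝ} (hτ : 0 < τ) {x v z : M} (hv : IsProximalPoint G τ x v) {a b : ℝ}
    (ha : G v = a) (hb : G z = b) :
    dist v z ^ 2 + dist v x ^ 2 + 2 * τ * (a - b) ≤ dist z x ^ 2 := by
  obtain ⟨γ, hγ, rfl, rfl⟩ := HadamardSpace.exists_geodesic v z
  -- Test minimality of `v` against `γ s`, divide by `s`, then let `s → 0`.
  have hstep : ∀ s ∈ Set.Ioc (0 : ℝ) 1,
      (1 - s) * dist (γ 0) (γ 1) ^ 2 + dist (γ 0) x ^ 2 + 2 * τ * (a - b) ≤ dist (γ 1) x ^ 2 := by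
    intro s hs
    have hs' : s ∈ Set.Icc (0 : ℝ) 1 := ⟨hs.1.le, hs.2⟩
    have hle := hconv.le_coe hγ ha hb hs'
    obtain ⟨r, hr⟩ := effDom_of_le_coe hbot hle
    have hp := hv (γ s)
    rw [hr] at hle hp
    rw [ha] at hp
    have hle' : r ≤ (1 - s) * a + s * b := by exact_mod_cast hle
    have hp' : dist (γ 0) x ^ 2 / 2 + τ * a ≤ dist (γ s) x ^ 2 / 2 + τ * r := by exact_mod_cast hp
    have hd := hγ.dist_sq_le x hs'
    have hτr := mul_le_mul_of_nonneg_left hle' hτ.le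
    refine le_of_mul_le_mul_left (a := s) ?_ hs.1
    linarith
  have hlim : Tendsto (fun s : ℝ => (1 - s) * dist (γ 0) (γ 1) ^ 2 + dist (γ 0) x ^ 2
      + 2 * τ * (a - b)) (𝓝[>] 0)
      (𝓝 ((1 - 0) * dist (γ 0) (γ 1) ^ 2 + dist (γ 0) x ^ 2 + 2 * τ * (a - b))) :=
    (Continuous.tendsto (by fun_prop) 0).mono_left nhdsWithin_le_nhds
  rw [sub_zero, one_mul] at hlim
  refine le_of_tendsto hlim ?_
  filter_upwards [Ioc_mem_nhdsGT (zero_lt_one' ℝ)] with s hs using hstep s hs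

/-- The proximal point satisfies the global slope bound with constant `d(v,x) / τ`. -/
theorem IsProximalPoint.sub_le [HadamardSpace M] (hbot : ∀ x, G x ≠ ⊥)
    (hconv : GeodesicallyConvex G) {τ : ℝ} (hτ : 0 < τ) {x v z : M} (hv : IsProximalPoint G τ x v)
    {a b : ℝ} (ha : G v = a) (hb : G z = b) :
    τ * (a - b) ≤ dist v x * dist v z := by
  have h := hv.evi hbot hconv hτ ha hb
  have ht : dist z x ≤ dist v z + dist v x := dist_triangle_left z x v
  have := pow_le_pow_left₀ dist_nonneg ht 2
  nlinarith

/-! ### Slopes and global lower bounds -/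

/-- A Lipschitz-type lower bound of `G` at `y` with constant `K` bounds the slope. -/
theorem slopeAt_le {y : M} {r K : ℝ} (hy : G y = r) (hK : 0 ≤ K)
    (h : ∀ z, ∀ b : ℝ, G z = b → r - b ≤ K * dist y z) (hbot : ∀ x, G x ≠ ⊥) :
    slopeAt G y ≤ ENNReal.ofReal K := by
  rw [slopeAt, if_pos ⟨r, hy⟩]
  refine limsup_le_of_le (by isBoundedDefault) (Eventually.of_forall fun z => ?_)
  refine ENNReal.div_le_of_le_mul ?_
  rw [hy, edist_dist, ← ENNReal.ofReal_mul hK]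
  by_cases hz : G z = ⊤
  · simp [hz]
  · have hb := (EReal.coe_toReal hz (hbot z)).symm
    rw [hb, ← EReal.coe_sub, EReal.toENNReal_of_ne_top (EReal.coe_ne_top _), EReal.toReal_coe]
    exact ENNReal.ofReal_le_ofReal (h z _ hb)

/-- For convex functions a finite slope is a global Lipschitz-type lower bound. -/
theorem sub_le_slopeAt_mul_dist [HadamardSpace M] (hbot : ∀ x, G x ≠ ⊥)
    (hconv : GeodesicallyConvex G) {y z : M} {a b : ℝ} (ha : G y = a) (hb : G z = b)
    (hfin : slopeAt G y ≠ ⊤) : a - b ≤ (slopeAt G y).toReal * dist y z := by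
  rcases eq_or_ne y z with rfl | hyz
  · rw [ha] at hb
    simp [EReal.coe_injective hb]
  obtain ⟨γ, hγ, rfl, rfl⟩ := HadamardSpace.exists_geodesic y z
  have hpos : 0 < dist (γ 0) (γ 1) := dist_pos.2 hyz
  have hIoc : ∀ᶠ s in 𝓝[>] (0 : ℝ), s ∈ Set.Ioc (0 : ℝ) 1 := Ioc_mem_nhdsGT zero_lt_one
  have hlim : Tendsto γ (𝓝[>] 0) (𝓝[≠] (γ 0)) := by
    refine tendsto_nhdsWithin_iff.2 ⟨tendsto_iff_dist_tendsto_zero.2 ?_, ?_⟩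
    · have h0 : Tendsto (fun s : ℝ => s * dist (γ 0) (γ 1)) (𝓝[>] 0)
          (𝓝 (0 * dist (γ 0) (γ 1))) :=
        (Continuous.tendsto (by fun_prop) 0).mono_left nhdsWithin_le_nhds
      rw [zero_mul] at h0
      refine h0.congr' ?_
      filter_upwards [hIoc] with s hs
      rw [dist_comm (γ s), hγ.dist_zero_left ⟨hs.1.le, hs.2⟩]
    · filter_upwards [hIoc] with s hs
      refine (dist_pos.1 ?_).symm
      rw [hγ.dist_zero_left ⟨hs.1.le, hs.2⟩]
      exact mul_pos hs.1 hpos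
  -- By convexity, difference quotients along the geodesic to `z` are at least the one at `z`.
  have hfreq : ∃ᶠ w in 𝓝[≠] (γ 0), ENNReal.ofReal ((a - b) / dist (γ 0) (γ 1)) ≤
      (G (γ 0) - G w).toENNReal / edist (γ 0) w := by
    refine hlim.frequently (Eventually.frequently ?_)
    filter_upwards [hIoc] with s hs
    have hs' : s ∈ Set.Icc (0 : ℝ) 1 := ⟨hs.1.le, hs.2⟩
    have hle := hconv.le_coe hγ ha hb hs'
    obtain ⟨r, hr⟩ := effDom_of_le_coe hbot hle
    rw [hr] at hle
    have hle' : r ≤ (1 - s) * a + s * b := by exact_mod_cast hle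
    have hspos : 0 < s * dist (γ 0) (γ 1) := mul_pos hs.1 hpos
    rw [ha, hr, ← EReal.coe_sub, EReal.toENNReal_of_ne_top (EReal.coe_ne_top _), EReal.toReal_coe,
      edist_dist, hγ.dist_zero_left hs', ← ENNReal.ofReal_div_of_pos hspos]
    refine ENNReal.ofReal_le_ofReal ?_
    rw [← mul_div_mul_left (a - b) _ hs.1.ne']
    gcongr
    linarith
  have hls := le_limsup_of_frequently_le hfreq (by isBoundedDefault)
  have hsl : slopeAt G (γ 0) = limsup (fun w => (G (γ 0) - G w).toENNReal / edist (γ 0) w)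
      (𝓝[≠] (γ 0)) := by rw [slopeAt, if_pos ⟨a, ha⟩]
  rw [← hsl] at hls
  exact (div_le_iff₀ hpos).1 ((ENNReal.ofReal_le_iff_le_toReal hfin).1 hls)

/-- Regularizing estimate for `n` proximal steps of size `τ`: the last step length is controlled by
the slope at an arbitrary reference point `z` and the distance from `z` to the starting point. -/
theorem proximal_last_step_le [HadamardSpace M] (hbot : ∀ x, G x ≠ ⊥)
    (hconv : GeodesicallyConvex G) {τ : ℝ} (hτ : 0 < τ) {x : ℕ → M} {g : ℕ → ℝ}
    (hg : ∀ j, G (x j) = g j) (hx : ∀ j, IsProximalPoint G τ (x j) (x (j + 1)))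
    {z : M} {b S : ℝ} (hb : G z = b) (hS : 0 ≤ S) (hlow : ∀ w, ∀ r : ℝ, G w = r →
      b - r ≤ S * dist z w) (n : ℕ) :
    (n + 1) * dist (x (n + 1)) (x n) ≤ (n + 1) * τ * S + dist z (x 0) := by
  have hdesc : ∀ j, dist (x (j + 1)) (x j) ^ 2 ≤ τ * (g j - g (j + 1)) := by
    intro j
    have := (hx j).evi hbot hconv hτ (hg (j + 1)) (hg j)
    rw [dist_self] at this
    linarith
  -- With `δ j` the length of step `j`, `δ (j+1) ^ 2 ≤ τ * (g (j+1) - g (j+2)) ≤ δ j * δ (j+1)`.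
  have hmono : ∀ j, dist (x (j + 2)) (x (j + 1)) ≤ dist (x (j + 1)) (x j) := by
    intro j
    have h₁ := hdesc (j + 1)
    have h₂ := (hx j).sub_le hbot hconv hτ (hg (j + 1)) (hg (j + 2))
    rw [dist_comm (x (j + 1)) (x (j + 2))] at h₂
    by_contra! hlt
    have := dist_nonneg (x := x (j + 1)) (y := x j)
    nlinarith
  have henergy : ∀ j : ℕ, ((j : ℝ) + 1) ^ 2 * dist (x (j + 1)) (x j) ^ 2
      + 2 * ((j + 1) * τ) * (g (j + 1) - b) + dist (x (j + 1)) z ^ 2 ≤ dist z (x 0) ^ 2 := by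
    intro j
    induction j with
    | zero =>
      have := (hx 0).evi hbot hconv hτ (hg 1) hb
      simp only [Nat.cast_zero, zero_add]
      linarith
    -- Split `(k+2)² = (k+1)² + 2(k+1) + 1`: the three parts are paid for by `hmono`, `hdesc` and
    -- the variational inequality.
    | succ k ih =>
      have hE := (hx (k + 1)).evi hbot hconv hτ (hg (k + 2)) hb
      rw [dist_comm z] at hE
      have hd := mul_le_mul_of_nonneg_left (hdesc (k + 1)) (by positivity : (0 : ℝ) ≤ k + 1)
      have hm := mul_le_mul_of_nonneg_left (pow_le_pow_left₀ dist_nonneg (hmono k) 2)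
        (by positivity : (0 : ℝ) ≤ ((k : ℝ) + 1) ^ 2)
      push_cast
      linarith
  have hE := henergy n
  have hl := hlow _ _ (hg (n + 1))
  rw [dist_comm] at hl
  have hn : (0 : ℝ) ≤ (n + 1) * τ := by positivity
  have hl' := mul_le_mul_of_nonneg_left hl hn
  refine le_of_sq_le_sq ?_ (by positivity)
  have := mul_nonneg (mul_nonneg hn hS) (dist_nonneg (x := z) (y := x 0))
  -- Completing the square absorbs the term `2 (n+1) τ S d(x (n+1), z)` into `d(x (n+1), z)²`.
  nlinarith [sq_nonneg ((n + 1) * τ * S - dist (x (n + 1)) z)]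

/-- Passing to the limit in global slope bounds, by lower semicontinuity. -/
theorem slopeAt_le_of_tendsto (hbot : ∀ x, G x ≠ ⊥) (hlsc : LowerSemicontinuous G)
    {y : ℕ → M} {y₀ z₀ : M} (hy : Tendsto y atTop (𝓝 y₀)) {K : ℝ} (hK : 0 ≤ K)
    (hz₀ : z₀ ∈ effDom G)
    (h : ∀ᶠ n in atTop, ∀ z, ∀ b : ℝ, G z = b → G (y n) ≤ ((b + K * dist (y n) z : ℝ) : EReal)) :
    slopeAt G y₀ ≤ ENNReal.ofReal K := by
  have hlim : ∀ z, ∀ b : ℝ, G z = b → G y₀ ≤ ((b + K * dist y₀ z : ℝ) : EReal) := by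
    intro z b hb
    refine le_of_forall_lt fun c hc => ?_
    have hc' : Tendsto (fun n => ((b + K * dist (y n) z : ℝ) : EReal)) atTop
        (𝓝 ((b + K * dist y₀ z : ℝ) : EReal)) :=
      (continuous_coe_real_ereal.tendsto _).comp
        (((hy.dist tendsto_const_nhds).const_mul K).const_add b)
    obtain ⟨d, hcd, hd⟩ := exists_between hc
    have hge : d ≤ ((b + K * dist y₀ z : ℝ) : EReal) := by
      refine ge_of_tendsto hc' ?_
      filter_upwards [h, hy.eventually (hlsc y₀ d hd)] with n hn hdn
      exact hdn.le.trans (hn z b hb)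
    exact hcd.trans_le hge
  obtain ⟨b₀, hb₀⟩ := hz₀
  obtain ⟨r, hr⟩ := effDom_of_le_coe hbot (hlim z₀ b₀ hb₀)
  refine slopeAt_le hr hK (fun z b hb => ?_) hbot
  have := hlim z b hb
  rw [hr] at this
  have : r ≤ b + K * dist y₀ z := by exact_mod_cast this
  linarith

/-! ### The slope along the flow -/

variable {c₀ : M} {c : ℝ → M}

theorem proximal_iterate_mem_effDom (hbot : ∀ x, G x ≠ ⊥) {τ : ℝ} (hτ : 0 < τ) {x : ℕ → M}
    (h0 : x 0 ∈ effDom G) (hx : ∀ j, IsProximalPoint G τ (x j) (x (j + 1))) (j : ℕ) :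
    x j ∈ effDom G := by
  cases j with
  | zero => exact h0
  | succ k => exact (hx k).mem_effDom hbot hτ h0

/-- Regularizing estimate for the weak gradient flow. -/
theorem IsWeakGradientFlow.slopeAt_le [HadamardSpace M] (hbot : ∀ x, G x ≠ ⊥)
    (hconv : GeodesicallyConvex G) (hlsc : LowerSemicontinuous G) (hc₀ : c₀ ∈ effDom G)
    (hc : IsWeakGradientFlow G c₀ c) {z : M} (hz : slopeAt G z ≠ ⊤) {t : ℝ} (ht : 0 < t) :
    slopeAt G (c t) ≤ ENNReal.ofReal ((slopeAt G z).toReal + dist z c₀ / t) := by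
  have hzdom : z ∈ effDom G := by
    by_contra hcon
    exact hz (by rw [slopeAt, if_neg hcon])
  obtain ⟨b, hb⟩ := hzdom
  obtain ⟨p, hp⟩ := hc
  obtain ⟨hstep, hlim⟩ := hp t ht.le
  refine slopeAt_le_of_tendsto hbot hlsc hlim (by positivity) hc₀ ?_
  filter_upwards [eventually_gt_atTop 0] with m hm w r hr
  obtain ⟨h0, hx⟩ := hstep m hm
  have hm' : (0 : ℝ) < m := by exact_mod_cast hm
  have hτ : 0 < t / m := by positivity
  have hdom := proximal_iterate_mem_effDom (x := fun j => p m j t) hbot hτ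
    (by simpa only [h0] using hc₀) hx
  choose g hg using hdom
  obtain ⟨n, rfl⟩ := Nat.exists_eq_succ_of_ne_zero hm.ne'
  have hest := proximal_last_step_le hbot hconv hτ hg hx hb ENNReal.toReal_nonneg
    (fun w r hr => sub_le_slopeAt_mul_dist hbot hconv hb hr hz) n
  have hsub := (hx n).sub_le hbot hconv hτ (hg (n + 1)) hr
  simp only [h0] at hest
  simp only [Nat.succ_eq_add_one] at *
  rw [hg (n + 1), EReal.coe_le_coe_iff]
  -- Here `(n + 1) * τ = t`, which turns `d(z, c₀) / (n + 1)` into `τ * d(z, c₀) / t`.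
  have hδ : dist (p (n + 1) (n + 1) t) (p (n + 1) n t) ≤
      t / ((n + 1 : ℕ) : ℝ) * ((slopeAt G z).toReal + dist z c₀ / t) := by
    push_cast at hest ⊢
    refine le_of_mul_le_mul_left (hest.trans_eq ?_) (by positivity : (0 : ℝ) < n + 1)
    field_simp
  have hfin := hsub.trans (mul_le_mul_of_nonneg_right hδ dist_nonneg)
  rw [mul_assoc] at hfin
  linarith [le_of_mul_le_mul_left hfin hτ]

/-- The slope along the weak gradient flow converges to the infimum of the slope. -/
theorem IsWeakGradientFlow.tendsto_slopeAt [HadamardSpace M] (hbot : ∀ x, G x ≠ ⊥)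
    (hconv : GeodesicallyConvex G) (hlsc : LowerSemicontinuous G) (hc₀ : c₀ ∈ effDom G)
    (hc : IsWeakGradientFlow G c₀ c) :
    Tendsto (fun t => slopeAt G (c t)) atTop (𝓝 (⨅ z, slopeAt G z)) := by
  refine tendsto_order.2 ⟨fun a ha => Eventually.of_forall fun t => ha.trans_le (iInf_le _ _),
    fun a ha => ?_⟩
  obtain ⟨z, hz⟩ := iInf_lt_iff.1 ha
  have hlim : Tendsto (fun t : ℝ => ENNReal.ofReal ((slopeAt G z).toReal + dist z c₀ / t)) atTop
      (𝓝 (slopeAt G z)) := by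
    have := ENNReal.tendsto_ofReal
      ((tendsto_const_nhds (x := dist z c₀)).div_atTop tendsto_id |>.const_add
        (slopeAt G z).toReal)
    rwa [add_zero, ENNReal.ofReal_toReal hz.ne_top] at this
  filter_upwards [hlim.eventually_lt_const hz, eventually_gt_atTop 0] with t h₁ h₂
  exact (hc.slopeAt_le hbot hconv hlsc hc₀ hz.ne_top h₂).trans_lt h₁

/-- A single proximal step of size `1` (`t = m = 1`) already lands at a point of finite slope. -/
theorem IsWeakGradientFlow.iInf_slopeAt_ne_top [HadamardSpace M] (hbot : ∀ x, G x ≠ ⊥)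
    (hconv : GeodesicallyConvex G) (hc₀ : c₀ ∈ effDom G) (hc : IsWeakGradientFlow G c₀ c) :
    ⨅ z, slopeAt G z ≠ ⊤ := by
  obtain ⟨p, hp⟩ := hc
  obtain ⟨h0, hx⟩ := (hp 1 zero_le_one).1 1 one_pos
  rw [Nat.cast_one, div_one] at hx
  have hv := hx 0
  rw [h0] at hv
  obtain ⟨r, hr⟩ := hv.mem_effDom hbot one_pos hc₀
  refine ((iInf_le _ (p 1 1 1)).trans_lt
    ((_root_.slopeAt_le hr (dist_nonneg (x := p 1 1 1) (y := c₀)) (fun z b hb => ?_) hbot).trans_lt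
      ENNReal.ofReal_lt_top)).ne
  simpa using hv.sub_le hbot hconv one_pos hr hb

end Hadamard

theorem proposition3p3 {M : Type*} [MetricSpace M] [HadamardSpace M]
    (G : M → EReal) (hbot : ∀ x, G x ≠ ⊥) (hconv : GeodesicallyConvex G)
    (hlsc : LowerSemicontinuous G)
    (φ₀ ψ₀ : M) (hφ₀ : φ₀ ∈ effDom G) (hψ₀ : ψ₀ ∈ effDom G)
    (φ ψ : ℝ → M) (hφ : IsWeakGradientFlow G φ₀ φ) (hψ : IsWeakGradientFlow G ψ₀ ψ) :
    ∃ L : ℝ≥0, Tendsto (fun t : ℝ => slopeAt G (φ t)) atTop (𝓝 (L : ℝ≥0∞)) ∧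
      Tendsto (fun t : ℝ => slopeAt G (ψ t)) atTop (𝓝 (L : ℝ≥0∞)) := by
  refine ⟨(⨅ z, slopeAt G z).toNNReal, ?_⟩
  rw [ENNReal.coe_toNNReal (hφ.iInf_slopeAt_ne_top hbot hconv hφ₀)]
  exact ⟨hφ.tendsto_slopeAt hbot hconv hlsc hφ₀, hψ.tendsto_slopeAt hbot hconv hlsc hψ₀⟩
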